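/- Let $\mathbf Q$ be the class of all $q\in C^2([0,1])$ with $0\le q(x)\le 1$ and $|q^{(i)}(x)|\le 1$ for all $x\in[0,1]$ and $i=0,1,2$. For $q\in\mathbf Q$ let $\lambda(q)$ be the smallest eigenvalue of the problem $-u''(x)+q(x)u(x)=\lambda u(x)$ for $x\in(0,1)$, $u(0)=u(1)=0$, $u\not\equiv 0$. A deterministic algorithm $\phi$ samples $q$ at points $t_1,t_2,\dots\in[0,1]$, where $t_i$ may depend on the previous points and values $t_1,q(t_1),\dots,t_{i-1},q(t_{i-1})$. After $n_q$ samples, where the decision to stop may also depend on the data collected so far, it returns a number $\phi(q)=\phi(q(t_1),\dots,q(t_{n_q}))$. The functions that choose the points, the stopping rule and the output are arbitrary. The algorithm uses $\sup_{q\in\mathbf Q}n_q$ function values, which is assumed to be finite. Its worst case error is $\sup_{q\in\mathbf Q}|\lambda(q)-\phi(q)|$. A randomized algorithm is a family $(\phi_\omega)$ of deterministic algorithms indexed by a probability space such that for every $q\in\mathbf Q$ the sample points $t_{i,\omega}$, the number $n_{q,\omega}$ of samples and the result $\phi_\omega(q)$ are measurable in $\omega$. It uses $\sup_{q\in\mathbf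 Q}\mathbb E(n_{q,\omega})$ function values, which is assumed to be finite. Its randomized error is $\sup_{q\in\mathbf Q}\bigl(\mathbb E\,(\lambda(q)-\phi_\omega(q))^2\bigr)^{1/2}$. Let $n^{\mathrm{wor}}(\varepsilon)$ be the minimal number of function values used by a deterministic algorithm with worst case error at most $\varepsilon$, and let $n^{\mathrm{ran}}(\varepsilon)$ be the infimum of the numbers of function values used by randomized algorithms with randomized error at most $\varepsilon$. Then, as $\varepsilon\to0^+$, $$n^{\mathrm{wor}}(\varepsilon)=\Omega(\varepsilon^{-1/2}),\qquad n^{\mathrm{ran}}(\varepsilon)=\Omega(\varepsilon^{-2/5}),$$ that is, there are constants $c,\varepsilon_0>0$ such that $n^{\mathrm{wor}}(\varepsilon)\ge c\,\varepsilon^{-1/2}$ and $n^{\mathrm{ran}}(\varepsilon)\ge c\,\varepsilon^{-2/5}$ for all $\varepsilon\in(0,\varepsilon_0]$. -/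

import Mathlib

open MeasureTheory Set
open scoped ENNReal

universe u

noncomputable section

namespace SturmLiouville

/-- The class of `C²` potentials `q : [0,1] → [0,1]` with `|q|, |q'|, |q''| ≤ 1` on `[0,1]`.
Functions are total on `ℝ`, but only their restriction to `[0,1]` is ever used. -/
def Q : Set (ℝ → ℝ) :=
  {q | (∀ x ∈ Icc (0 : ℝ) 1, q x ∈ Icc (0 : ℝ) 1) ∧
    ContDiffOn ℝ 2 q (Icc 0 1) ∧
    ∀ i ≤ 2, ∀ x ∈ Icc (0 : ℝ) 1, |iteratedDerivWithin i q (Icc 0 1) x| ≤ 1}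

/-- `μ` is an eigenvalue of `u ↦ -u'' + q u` on `(0,1)` with `u(0) = u(1) = 0`:
there is a `C²` eigenfunction that is not identically zero on `[0,1]`. -/
def IsEigenvalue (q : ℝ → ℝ) (μ : ℝ) : Prop :=
  ∃ u : ℝ → ℝ, ContDiffOn ℝ 2 u (Icc 0 1) ∧
    (∃ x ∈ Icc (0 : ℝ) 1, u x ≠ 0) ∧ u 0 = 0 ∧ u 1 = 0 ∧
    ∀ x ∈ Ioo (0 : ℝ) 1, -iteratedDerivWithin 2 u (Icc 0 1) x + q x * u x = μ * u x

/-- The smallest eigenvalue `λ(q)`. -/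
def smallestEigenvalue (q : ℝ → ℝ) : ℝ :=
  sInf {μ | IsEigenvalue q μ}

/-- The sample points with their function values, the most recent one first. -/
abbrev Data : Type := List (Icc (0 : ℝ) 1 × ℝ)

/-- A deterministic adaptive algorithm: the next sample point, the decision to stop sampling and
the final output are arbitrary functions of the data collected so far. -/
structure Algorithm where
  point : Data → Icc (0 : ℝ) 1
  halt : Data → Prop
  out : Data → ℝ

namespace Algorithm

/-- The data after `k` samples of `q`. -/
def data (A : Algorithm) (q : ℝ → ℝ) : ℕ → Data
  | 0 => []
  | k + 1 => (A.point (A.data q k), q (A.point (A.data q k))) :: A.data q k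

/-- The sample point that follows the first `i` samples of `q` (indices start at `0`). -/
def samplePoint (A : Algorithm) (q : ℝ → ℝ) (i : ℕ) : Icc (0 : ℝ) 1 :=
  A.point (A.data q i)

/-- The number of function values used for `q`, that is, the first `k` at which the algorithm
stops; it is `⊤` if the algorithm never stops. -/
def numSamples (A : Algorithm) (q : ℝ → ℝ) : ℕ∞ :=
  sInf {m : ℕ∞ | ∃ k : ℕ, m = k ∧ A.halt (A.data q k)}

/-- The approximation computed for `q` (meaningful when the algorithm stops on `q`). -/
def result (A : Algorithm) (q : ℝ → ℝ) : ℝ :=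
  A.out (A.data q (A.numSamples q).toNat)

/-- The worst case number of function values. -/
def worstNumSamples (A : Algorithm) : ℕ∞ :=
  ⨆ q ∈ Q, A.numSamples q

/-- The worst case error. -/
def worstError (A : Algorithm) : ℝ≥0∞ :=
  ⨆ q ∈ Q, ENNReal.ofReal |smallestEigenvalue q - A.result q|

end Algorithm

/-- The minimal number of function values for worst case error at most `ε`. -/
def nWor (ε : ℝ) : ℕ∞ :=
  sInf {n : ℕ∞ | n < ⊤ ∧ ∃ A : Algorithm,
    A.worstNumSamples = n ∧ A.worstError ≤ ENNReal.ofReal ε}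

/-- A randomized algorithm on the probability space `Ω`: a random deterministic algorithm whose
sample points, number of samples and result are measurable for every potential in the class. -/
structure RandomizedAlgorithm (Ω : Type u) [MeasurableSpace Ω] where
  alg : Ω → Algorithm
  measurable_samplePoint : ∀ q ∈ Q, ∀ i, Measurable fun ω => (alg ω).samplePoint q i
  measurable_numSamples : ∀ q ∈ Q, Measurable fun ω => (alg ω).numSamples q
  measurable_result : ∀ q ∈ Q, Measurable fun ω => (alg ω).result q

namespace RandomizedAlgorithm

variable {Ω : Type u} [MeasurableSpace Ω]

/-- The supremum over the class of the expected number of function values. -/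
def expectedNumSamples (A : RandomizedAlgorithm Ω) (P : Measure Ω) : ℝ≥0∞ :=
  ⨆ q ∈ Q, ∫⁻ ω, ((A.alg ω).numSamples q : ℝ≥0∞) ∂P

/-- The randomized error: the supremum over the class of the `L₂` norm of the error. -/
def error (A : RandomizedAlgorithm Ω) (P : Measure Ω) : ℝ≥0∞ :=
  ⨆ q ∈ Q, eLpNorm (fun ω => smallestEigenvalue q - (A.alg ω).result q) 2 P

end RandomizedAlgorithm

/-- The minimal (infimal) expected number of function values for randomized error at most `ε`,
over all probability spaces in the universe `u`. -/
def nRan (ε : ℝ) : ℝ≥0∞ :=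
  sInf {n : ℝ≥0∞ | n < ⊤ ∧
    ∃ (Ω : Type u) (_ : MeasurableSpace Ω) (P : Measure Ω) (_ : IsProbabilityMeasure P)
      (A : RandomizedAlgorithm Ω),
      A.expectedNumSamples P = n ∧ A.error P ≤ ENNReal.ofReal ε}

end SturmLiouville

end

/-! The lower bounds come from potentials that samples cannot tell apart. The middle half of `[0,1]`
carries `m` disjoint bumps of width `1/(2m)` and height of order `m⁻²`, the largest order that the
bound on second derivatives allows, so each has integral of order `m⁻³`. A sample meets at most one
bump.

Each added bump raises the smallest eigenvalue by at least some `δ` of order `m⁻³`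
(`IsPotential.le_smallestEigenvalue_sub`): for ground states `u₁`, `u₂` the Wronskian gives `(λ₂ -
λ₁) ∫ u₁u₂ = ∫ (q₂ - q₁)u₁u₂`, and concavity keeps both functions comparable to their maxima on the
middle half. Ground states are found by shooting with the Prüfer angle; Sturm comparison identifies
their energy with `smallestEigenvalue`.

Deterministic case: with `m = 2(n+1)`, more than `n` bumps are missed when the zero potential is
sampled. Adding all of them leaves the output unchanged but moves the eigenvalue by order `n · m⁻³`,
that is `n⁻²`.

Randomized case: average over all sets of bumps. Given the data, the missed bumps act as independent
fair signs, so the mean square error is at least `δ²/4` times the mean number of missed bumps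
(`sum_card_le_sum_sq_sub`). With `m` about `2N`, where `N` bounds the expected number of samples,
this is of order `N⁻⁵`. -/

namespace SturmLiouville

/-- `u` solves `-u'' + q u = μ u` on `[0,1]`, with derivative `p`. -/
structure IsSolution (q : ℝ → ℝ) (μ : ℝ) (u p : ℝ → ℝ) : Prop where
  hasDeriv : ∀ x ∈ Icc (0 : ℝ) 1, HasDerivWithinAt u (p x) (Icc 0 1) x
  hasDeriv' : ∀ x ∈ Icc (0 : ℝ) 1, HasDerivWithinAt p ((q x - μ) * u x) (Icc 0 1) x

/-- A solution that satisfies the boundary conditions and is positive on `(0,1)`. -/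
structure IsGroundState (q : ℝ → ℝ) (μ : ℝ) (u p : ℝ → ℝ) : Prop extends IsSolution q μ u p where
  left : u 0 = 0
  right : u 1 = 0
  pos : ∀ x ∈ Ioo (0 : ℝ) 1, 0 < u x

/-- Continuous potentials with values in `[0,1]`. -/
structure IsPotential (q : ℝ → ℝ) : Prop where
  continuous : Continuous q
  nonneg : ∀ x, 0 ≤ q x
  le_one : ∀ x, q x ≤ 1

/-! ### Existence of the ground state by the Prüfer angle -/

lemma abs_sin_sq_sub_sin_sq_le (a b : ℝ) : |Real.sin a ^ 2 - Real.sin b ^ 2| ≤ |a - b| := by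
  have h : Real.sin a ^ 2 - Real.sin b ^ 2 = Real.sin (a - b) * Real.sin (a + b) := by
    rw [Real.sin_sub, Real.sin_add]
    nlinarith [Real.sin_sq_add_cos_sq a, Real.sin_sq_add_cos_sq b]
  rw [h, abs_mul]
  calc |Real.sin (a - b)| * |Real.sin (a + b)| ≤ |a - b| * 1 :=
        mul_le_mul Real.abs_sin_le_abs (Real.abs_sin_le_one _) (abs_nonneg _) (abs_nonneg _)
    _ = _ := mul_one _

/-- The right-hand side of the differential equation for the scaled Prüfer angle
`tan θ = π u / u'` at the spectral parameter `π² + ν`. -/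
noncomputable def pruferField (q : ℝ → ℝ) (ν t θ : ℝ) : ℝ :=
  Real.pi + (ν - q t) / Real.pi * Real.sin θ ^ 2

section Prufer

variable {q : ℝ → ℝ}

lemma IsPotential.abs_div_pi_le (hq : IsPotential q) {ν : ℝ} (hν : ν ∈ Icc (0 : ℝ) 1) (t : ℝ) :
    |(ν - q t) / Real.pi| ≤ 1 := by
  have := hq.nonneg t
  have := hq.le_one t
  have hpi := Real.pi_gt_three
  rw [abs_div, abs_of_pos Real.pi_pos, div_le_one Real.pi_pos, abs_le]
  constructor <;> linarith [hν.1, hν.2]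

lemma IsPotential.lipschitzWith_pruferField (hq : IsPotential q)
    {ν : ℝ} (hν : ν ∈ Icc (0 : ℝ) 1) (t : ℝ) :
    LipschitzWith 1 (pruferField q ν t) := by
  refine LipschitzWith.of_dist_le_mul fun a b => ?_
  rw [Real.dist_eq, Real.dist_eq, pruferField, pruferField, NNReal.coe_one, one_mul,
    show Real.pi + (ν - q t) / Real.pi * Real.sin a ^ 2 -
      (Real.pi + (ν - q t) / Real.pi * Real.sin b ^ 2) =
      (ν - q t) / Real.pi * (Real.sin a ^ 2 - Real.sin b ^ 2) by ring, abs_mul]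
  calc _ ≤ 1 * |a - b| := mul_le_mul (hq.abs_div_pi_le hν t) (abs_sin_sq_sub_sin_sq_le a b)
          (abs_nonneg _) zero_le_one
    _ = _ := one_mul _

lemma IsPotential.abs_pruferField_sub_pi_le (hq : IsPotential q)
    {ν : ℝ} (hν : ν ∈ Icc (0 : ℝ) 1) (t θ : ℝ) :
    |pruferField q ν t θ - Real.pi| ≤ 1 := by
  rw [pruferField, add_sub_cancel_left, abs_mul]
  refine mul_le_one₀ (hq.abs_div_pi_le hν t) (abs_nonneg _) ?_
  rw [abs_of_nonneg (sq_nonneg _)]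
  exact Real.sin_sq_le_one θ

/-- The field is bounded by `π + 1`, so a ball of that radius confines the angle for unit time and
Picard–Lindelöf covers the whole interval. -/
lemma IsPotential.exists_pruferAngle (hq : IsPotential q) {ν : ℝ} (hν : ν ∈ Icc (0 : ℝ) 1) :
    ∃ θ : ℝ → ℝ, θ 0 = 0 ∧
      ∀ t ∈ Icc (0 : ℝ) 1, HasDerivWithinAt θ (pruferField q ν t (θ t)) (Icc 0 1) t := by
  have hL : (0 : ℝ) ≤ Real.pi + 1 := by positivity
  have h : IsPicardLindelof (pruferField q ν) (tmin := 0) (tmax := 1)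
      (⟨0, by simp⟩ : Icc (0 : ℝ) 1) 0 ⟨Real.pi + 1, hL⟩ 0 ⟨Real.pi + 1, hL⟩ 1 := by
    refine ⟨fun t _ => (hq.lipschitzWith_pruferField hν t).lipschitzOnWith, ?_, ?_, ?_⟩
    · intro x _
      have := hq.continuous
      unfold pruferField
      fun_prop
    · intro t _ x _
      have h1 := hq.abs_pruferField_sub_pi_le hν t x
      rw [abs_le] at h1
      rw [Real.norm_eq_abs, abs_le]
      change _ ∧ _ ≤ Real.pi + 1
      change -(Real.pi + 1) ≤ _ ∧ _
      constructor <;> linarith [Real.pi_pos]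
    · simp
  exact h.exists_eq_forall_mem_Icc_hasDerivWithinAt₀

/-- Grönwall's inequality, the two fields differing by at most `|ν - ν'|/π`. It makes the terminal
angle continuous in `ν`, as shooting requires. -/
lemma IsPotential.dist_pruferAngle_le (hq : IsPotential q)
    {ν ν' : ℝ} (hν : ν ∈ Icc (0 : ℝ) 1) {θ θ' : ℝ → ℝ}
    (h0 : θ 0 = 0) (h0' : θ' 0 = 0)
    (hθ : ∀ t ∈ Icc (0 : ℝ) 1, HasDerivWithinAt θ (pruferField q ν t (θ t)) (Icc 0 1) t)
    (hθ' : ∀ t ∈ Icc (0 : ℝ) 1, HasDerivWithinAt θ' (pruferField q ν' t (θ' t)) (Icc 0 1) t) :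
    dist (θ 1) (θ' 1) ≤ (Real.exp 1 - 1) * dist ν ν' := by
  have hright : ∀ {f : ℝ → ℝ} {f' t : ℝ}, t ∈ Ico (0 : ℝ) 1 →
      HasDerivWithinAt f f' (Icc 0 1) t → HasDerivWithinAt f f' (Ici t) t := by
    intro f f' t ht h
    exact (h.mono (Icc_subset_Icc_left ht.1)).mono_of_mem_nhdsWithin (Icc_mem_nhdsGE ht.2)
  have key := dist_le_of_approx_trajectories_ODE (v := pruferField q ν) (K := 1)
    (f := θ) (g := θ') (f' := fun t => pruferField q ν t (θ t))
    (g' := fun t => pruferField q ν' t (θ' t)) (a := 0) (b := 1) (εf := 0) (εg := dist ν ν')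
    (δ := 0) (hq.lipschitzWith_pruferField hν)
    (fun t ht => (hθ t ht).continuousWithinAt)
    (fun t ht => hright ht (hθ t (Ico_subset_Icc_self ht))) (fun t _ => by simp)
    (fun t ht => (hθ' t ht).continuousWithinAt)
    (fun t ht => hright ht (hθ' t (Ico_subset_Icc_self ht)))
    (fun t _ => by
      rw [Real.dist_eq, pruferField, pruferField,
        show Real.pi + (ν' - q t) / Real.pi * Real.sin (θ' t) ^ 2 -
          (Real.pi + (ν - q t) / Real.pi * Real.sin (θ' t) ^ 2) =
          (ν' - ν) * (Real.sin (θ' t) ^ 2 / Real.pi) by ring, abs_mul, dist_comm ν ν',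
        Real.dist_eq]
      refine mul_le_of_le_one_right (abs_nonneg _) ?_
      rw [abs_of_nonneg (by positivity), div_le_one Real.pi_pos]
      linarith [Real.sin_sq_le_one (θ' t), Real.pi_gt_three])
    (by simp [h0, h0']) 1 (by simp)
  rw [gronwallBound_of_K_ne_0 (by simp)] at key
  simpa [mul_comm] using key

/-- For a suitable spectral parameter the Prüfer angle runs from `0` to `π`. -/
lemma IsPotential.exists_pruferAngle_eq_pi (hq : IsPotential q) :
    ∃ ν ∈ Icc (0 : ℝ) 1, ∃ θ : ℝ → ℝ, θ 0 = 0 ∧ θ 1 = Real.pi ∧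
      ∀ t ∈ Icc (0 : ℝ) 1, HasDerivWithinAt θ (pruferField q ν t (θ t)) (Icc 0 1) t := by
  choose! θ h0 hθ using fun ν (hν : ν ∈ Icc (0 : ℝ) 1) => hq.exists_pruferAngle hν
  have hcont : ContinuousOn (fun ν => θ ν 1) (Icc 0 1) := by
    have hnn : (0 : ℝ) ≤ Real.exp 1 - 1 := by linarith [Real.add_one_le_exp (1 : ℝ)]
    refine LipschitzOnWith.continuousOn (K := ⟨Real.exp 1 - 1, hnn⟩) ?_
    refine LipschitzOnWith.of_dist_le_mul fun ν hν ν' hν' => ?_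
    exact hq.dist_pruferAngle_le hν (h0 ν hν) (h0 ν' hν') (hθ ν hν) (hθ ν' hν')
  have hint : ∀ ν ∈ Icc (0 : ℝ) 1, ∀ x ∈ interior (Icc (0 : ℝ) 1),
      HasDerivWithinAt (fun x => θ ν x - Real.pi * x)
        (pruferField q ν x (θ ν x) - Real.pi) (interior (Icc 0 1)) x := by
    intro ν hν x hx
    have := (hasDerivWithinAt_id x (interior (Icc (0 : ℝ) 1))).const_mul Real.pi
    rw [mul_one] at this
    exact ((hθ ν hν x (interior_subset hx)).mono interior_subset).sub this
  have hc : ∀ ν ∈ Icc (0 : ℝ) 1, ContinuousOn (fun x => θ ν x - Real.pi * x) (Icc 0 1) := by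
    intro ν hν
    have : ContinuousOn (θ ν) (Icc 0 1) := fun x hx => (hθ ν hν x hx).continuousWithinAt
    fun_prop
  have m0 : (0 : ℝ) ∈ Icc (0 : ℝ) 1 := by simp
  have m1 : (1 : ℝ) ∈ Icc (0 : ℝ) 1 := by simp
  -- As `0 ≤ q ≤ 1`, the angular speed is at most `π` for `ν = 0` and at least `π` for `ν = 1`, so
  -- the terminal angles bracket `π`.
  have hlow : θ 0 1 ≤ Real.pi := by
    have := antitoneOn_of_hasDerivWithinAt_nonpos (convex_Icc (0 : ℝ) 1) (hc 0 m0) (hint 0 m0)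
      (fun x _ => by
        rw [pruferField, add_sub_cancel_left]
        refine mul_nonpos_of_nonpos_of_nonneg ?_ (sq_nonneg _)
        exact div_nonpos_of_nonpos_of_nonneg (by linarith [hq.nonneg x]) Real.pi_pos.le)
      m0 m1 zero_le_one
    simp only [h0 0 m0] at this
    linarith
  have hhigh : Real.pi ≤ θ 1 1 := by
    have := monotoneOn_of_hasDerivWithinAt_nonneg (convex_Icc (0 : ℝ) 1) (hc 1 m1) (hint 1 m1)
      (fun x _ => by
        rw [pruferField, add_sub_cancel_left]
        refine mul_nonneg ?_ (sq_nonneg _)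
        exact div_nonneg (by linarith [hq.le_one x]) Real.pi_pos.le)
      m0 m1 zero_le_one
    simp only [h0 1 m1] at this
    linarith
  obtain ⟨ν, hν, h⟩ := intermediate_value_Icc zero_le_one hcont ⟨hlow, hhigh⟩
  exact ⟨ν, hν, θ ν, h0 ν hν, h, hθ ν hν⟩

/-- Every potential has a ground state, with energy at least `π²`. -/
theorem IsPotential.exists_isGroundState (hq : IsPotential q) :
    ∃ μ, Real.pi ^ 2 ≤ μ ∧ ∃ u p, IsGroundState q μ u p := by
  obtain ⟨ν, hν, θ, h0, h1, hθ⟩ := hq.exists_pruferAngle_eq_pi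
  have hpi := Real.pi_pos
  have hθc : ContinuousOn θ (Icc 0 1) := fun x hx => (hθ x hx).continuousWithinAt
  -- Clamping extends `θ` continuously to the line, so that the integral of `g` is differentiable
  -- also at the end points.
  set Θ : ℝ → ℝ := fun x => θ (projIcc 0 1 zero_le_one x) with hΘ
  have hΘc : Continuous Θ :=
    hθc.comp_continuous (continuous_subtype_val.comp continuous_projIcc) fun x => Subtype.prop _
  have hΘe : ∀ x ∈ Icc (0 : ℝ) 1, Θ x = θ x := fun x hx => by simp [hΘ, projIcc_of_mem _ hx]
  set g : ℝ → ℝ := fun x => -((ν - q x) / Real.pi) * Real.sin (Θ x) * Real.cos (Θ x) with hg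
  have hgc : Continuous g := by
    have := hq.continuous
    fun_prop
  set r : ℝ → ℝ := fun x => Real.exp (∫ t in (0 : ℝ)..x, g t) with hr
  have hr' : ∀ x, HasDerivAt r (r x * g x) x := fun x =>
    (hgc.integral_hasStrictDerivAt 0 x).hasDerivAt.exp
  -- The speed is at least `π - 1 > 0`, so the angle stays in `(0, π)` on the open interval and its
  -- sine is positive.
  have hmono : StrictMonoOn θ (Icc 0 1) := by
    refine strictMonoOn_of_hasDerivWithinAt_pos (convex_Icc 0 1) hθc
      (fun x hx => (hθ x (interior_subset hx)).mono interior_subset) fun x hx => ?_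
    have := (abs_le.1 (hq.abs_pruferField_sub_pi_le hν x (θ x))).1
    linarith [Real.pi_gt_three]
  refine ⟨Real.pi ^ 2 + ν, by linarith [hν.1], fun x => r x * Real.sin (θ x) / Real.pi,
    fun x => r x * Real.cos (θ x), ⟨⟨fun x hx => ?_, fun x hx => ?_⟩, ?_, ?_, fun x hx => ?_⟩⟩
  · have h := (((hr' x).hasDerivWithinAt (s := Icc 0 1)).mul (hθ x hx).sin).div_const Real.pi
    refine h.congr_deriv ?_
    simp only [hg, hΘe x hx, pruferField]
    field_simp
    ring
  · have h := ((hr' x).hasDerivWithinAt (s := Icc 0 1)).mul (hθ x hx).cos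
    refine h.congr_deriv ?_
    simp only [hg, hΘe x hx, pruferField]
    have := Real.sin_sq_add_cos_sq (θ x)
    field_simp
    linear_combination (q x - ν) * r x * Real.sin (θ x) * this
  · simp [h0]
  · simp [h1]
  · have hx' := Ioo_subset_Icc_self hx
    have h2 : 0 < θ x := h0 ▸ hmono (by simp) hx' hx.1
    have h3 : θ x < Real.pi := h1 ▸ hmono hx' (by simp) hx.2
    have := Real.sin_pos_of_pos_of_lt_pi h2 h3
    have : 0 < r x := Real.exp_pos _
    positivity

end Prufer

/-! ### Wronskians and regularity of eigenfunctions -/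

namespace IsSolution

variable {q : ℝ → ℝ} {μ : ℝ} {u p : ℝ → ℝ}

lemma continuousOn (h : IsSolution q μ u p) : ContinuousOn u (Icc 0 1) :=
  fun x hx => (h.hasDeriv x hx).continuousWithinAt

lemma neg (h : IsSolution q μ u p) : IsSolution q μ (fun x => -u x) (fun x => -p x) where
  hasDeriv x hx := (h.hasDeriv x hx).neg
  hasDeriv' x hx := (h.hasDeriv' x hx).neg.congr_deriv (by ring)

/-- The derivative of the Wronskian of two solutions. -/
lemma hasDerivWithinAt_wronskian {q' : ℝ → ℝ} {μ' : ℝ} {v r : ℝ → ℝ} (h : IsSolution q μ u p)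
    (h' : IsSolution q' μ' v r) {x : ℝ} (hx : x ∈ Icc (0 : ℝ) 1) :
    HasDerivWithinAt (fun x => u x * r x - p x * v x)
      ((q' x - q x - (μ' - μ)) * (u x * v x)) (Icc 0 1) x :=
  (((h.hasDeriv x hx).mul (h'.hasDeriv' x hx)).sub
    ((h.hasDeriv' x hx).mul (h'.hasDeriv x hx))).congr_deriv (by ring)

lemma contDiffOn (hq : Continuous q) (h : IsSolution q μ u p) : ContDiffOn ℝ 2 u (Icc 0 1) := by
  have hs := uniqueDiffOn_Icc (zero_lt_one (α := ℝ))
  rw [show (2 : WithTop ℕ∞) = 1 + 1 by norm_num, contDiffOn_succ_iff_derivWithin hs]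
  refine ⟨fun x hx => (h.hasDeriv x hx).differentiableWithinAt, by simp, ?_⟩
  have h1 : EqOn (derivWithin u (Icc 0 1)) p (Icc 0 1) :=
    fun x hx => (h.hasDeriv x hx).derivWithin (hs x hx)
  rw [contDiffOn_congr h1, contDiffOn_one_iff_derivWithin hs]
  refine ⟨fun x hx => (h.hasDeriv' x hx).differentiableWithinAt, ?_⟩
  have h2 : EqOn (derivWithin p (Icc 0 1)) (fun x => (q x - μ) * u x) (Icc 0 1) :=
    fun x hx => (h.hasDeriv' x hx).derivWithin (hs x hx)
  rw [continuousOn_congr h2]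
  have := h.continuousOn
  fun_prop

lemma iteratedDerivWithin_two (h : IsSolution q μ u p) {x : ℝ} (hx : x ∈ Icc (0 : ℝ) 1) :
    iteratedDerivWithin 2 u (Icc 0 1) x = (q x - μ) * u x := by
  have hs := uniqueDiffOn_Icc (zero_lt_one (α := ℝ))
  rw [show 2 = 1 + 1 from rfl, iteratedDerivWithin_succ, iteratedDerivWithin_one]
  have h1 : EqOn (derivWithin u (Icc 0 1)) p (Icc 0 1) :=
    fun x hx => (h.hasDeriv x hx).derivWithin (hs x hx)
  rw [derivWithin_congr h1 (h1 hx)]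
  exact (h.hasDeriv' x hx).derivWithin (hs x hx)

end IsSolution

/-- An eigenfunction is a solution, up to the boundary. -/
lemma IsEigenvalue.exists_isSolution {q : ℝ → ℝ} (hq : Continuous q) {μ : ℝ}
    (h : IsEigenvalue q μ) : ∃ u p, IsSolution q μ u p ∧
      (∃ x ∈ Icc (0 : ℝ) 1, u x ≠ 0) ∧ u 0 = 0 ∧ u 1 = 0 := by
  obtain ⟨u, hu, hne, h0, h1, hode⟩ := h
  have hs := uniqueDiffOn_Icc (zero_lt_one (α := ℝ))
  refine ⟨u, derivWithin u (Icc 0 1), ⟨fun x hx => ?_, fun x hx => ?_⟩, hne, h0, h1⟩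
  · exact (hu.differentiableOn (by norm_num) x hx).hasDerivWithinAt
  · have hd : ContDiffOn ℝ 1 (derivWithin u (Icc 0 1)) (Icc 0 1) :=
      hu.derivWithin hs (by norm_num)
    have heq : EqOn (derivWithin (derivWithin u (Icc 0 1)) (Icc 0 1))
        (fun x => (q x - μ) * u x) (Icc 0 1) := by
      -- Both sides are continuous on `[0,1]`, so the equation extends from the open interval to the
      -- end points.
      refine Set.EqOn.of_subset_closure (s := Ioo 0 1) (fun y hy => ?_)
        (hd.continuousOn_derivWithin hs le_rfl) ?_ Ioo_subset_Icc_self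
        (by rw [closure_Ioo zero_ne_one])
      · have := hode y hy
        rw [show 2 = 1 + 1 from rfl, iteratedDerivWithin_succ, iteratedDerivWithin_one] at this
        linarith
      · have := hu.continuousOn
        fun_prop
    exact (hd.differentiableOn (by norm_num) x hx).hasDerivWithinAt.congr_deriv (heq hx)

/-! ### Sturm comparison: the ground state energy is the smallest eigenvalue -/

/-- Together with its mirror image, this fixes the signs of the boundary terms of the Wronskian on a
nodal interval. -/
lemma nonneg_of_hasDerivWithinAt_of_left {f : ℝ → ℝ} {f' a b : ℝ} (hab : a < b)
    (h : HasDerivWithinAt f f' (Icc a b) a) (ha : f a = 0) (hf : ∀ x ∈ Ioo a b, 0 ≤ f x) :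
    0 ≤ f' := by
  have h1 := hasDerivWithinAt_iff_tendsto_slope.1 (h.mono Ioo_subset_Icc_self)
  rw [sdiff_singleton_eq_self (by simp)] at h1
  have : (nhdsWithin a (Ioo a b)).NeBot := by
    rw [← mem_closure_iff_nhdsWithin_neBot, closure_Ioo hab.ne]
    exact left_mem_Icc.2 hab.le
  refine ge_of_tendsto h1 (Filter.eventually_of_mem self_mem_nhdsWithin fun x hx => ?_)
  rw [slope_def_field, ha, sub_zero]
  exact div_nonneg (hf x hx) (sub_nonneg.2 hx.1.le)

lemma nonpos_of_hasDerivWithinAt_of_right {f : ℝ → ℝ} {f' a b : ℝ} (hab : a < b)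
    (h : HasDerivWithinAt f f' (Icc a b) b) (hb : f b = 0) (hf : ∀ x ∈ Ioo a b, 0 ≤ f x) :
    f' ≤ 0 := by
  have h1 := hasDerivWithinAt_iff_tendsto_slope.1 (h.mono Ioo_subset_Icc_self)
  rw [sdiff_singleton_eq_self (by simp)] at h1
  have : (nhdsWithin b (Ioo a b)).NeBot := by
    rw [← mem_closure_iff_nhdsWithin_neBot, closure_Ioo hab.ne]
    exact right_mem_Icc.2 hab.le
  refine le_of_tendsto h1 (Filter.eventually_of_mem self_mem_nhdsWithin fun x hx => ?_)
  rw [slope_def_field, hb, sub_zero]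
  exact div_nonpos_of_nonneg_of_nonpos (hf x hx) (sub_nonpos.2 hx.2.le)

/-- A continuous function that vanishes at the end points of an interval is positive on an open
interval around each point where it is positive, and vanishes at its end points. -/
lemma exists_nodal_interval {f : ℝ → ℝ} {a b x : ℝ} (hf : ContinuousOn f (Icc a b))
    (ha : f a = 0) (hb : f b = 0) (hx : x ∈ Icc a b) (hfx : 0 < f x) :
    ∃ c d, a ≤ c ∧ c < d ∧ d ≤ b ∧ f c = 0 ∧ f d = 0 ∧ ∀ y ∈ Ioo c d, 0 < f y := by
  have hZ1 : IsCompact (Icc a x ∩ f ⁻¹' {0}) :=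
    isCompact_Icc.of_isClosed_subset
      ((hf.mono (Icc_subset_Icc_right hx.2)).preimage_isClosed_of_isClosed
        isClosed_Icc isClosed_singleton) inter_subset_left
  have hZ2 : IsCompact (Icc x b ∩ f ⁻¹' {0}) :=
    isCompact_Icc.of_isClosed_subset
      ((hf.mono (Icc_subset_Icc_left hx.1)).preimage_isClosed_of_isClosed
        isClosed_Icc isClosed_singleton) inter_subset_left
  -- `c` is the last zero before `x` and `d` the first one after it; a nonpositive value in between
  -- would produce another zero.
  obtain ⟨c, hc, hcmax⟩ := hZ1.exists_isGreatest ⟨a, ⟨le_rfl, hx.1⟩, ha⟩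
  obtain ⟨d, hd, hdmin⟩ := hZ2.exists_isLeast ⟨b, ⟨hx.2, le_rfl⟩, hb⟩
  have hc0 : f c = 0 := hc.2
  have hd0 : f d = 0 := hd.2
  have hcx : c < x := lt_of_le_of_ne hc.1.2 (by rintro rfl; linarith)
  have hxd : x < d := lt_of_le_of_ne hd.1.1 (by rintro rfl; linarith)
  refine ⟨c, d, hc.1.1, hcx.trans hxd, hd.1.2, hc0, hd0, fun y hy => ?_⟩
  by_contra! hneg
  rcases le_total y x with hyx | hxy
  · obtain ⟨z, hz, hz0⟩ := intermediate_value_Icc hyx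
      (hf.mono (Icc_subset_Icc (hc.1.1.trans hy.1.le) hx.2)) ⟨hneg, hfx.le⟩
    have := hcmax ⟨⟨hc.1.1.trans (hy.1.le.trans hz.1), hz.2⟩, hz0⟩
    linarith [hy.1, hz.1]
  · obtain ⟨z, hz, hz0⟩ := intermediate_value_Icc' hxy
      (hf.mono (Icc_subset_Icc hx.1 (hy.2.le.trans hd.1.2))) ⟨hneg, hfx.le⟩
    have := hdmin ⟨⟨hz.1, hz.2.trans (hy.2.le.trans hd.1.2)⟩, hz0⟩
    linarith [hy.2, hz.2]

namespace IsGroundState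

variable {q : ℝ → ℝ} {μ : ℝ} {u p : ℝ → ℝ}

lemma nonneg (h : IsGroundState q μ u p) {x : ℝ} (hx : x ∈ Icc (0 : ℝ) 1) : 0 ≤ u x := by
  rcases eq_or_lt_of_le hx.1 with rfl | h0
  · exact h.left.ge
  rcases eq_or_lt_of_le hx.2 with rfl | h1
  · exact h.right.ge
  exact (h.pos x ⟨h0, h1⟩).le

lemma isEigenvalue (hq : Continuous q) (h : IsGroundState q μ u p) : IsEigenvalue q μ := by
  refine ⟨u, h.contDiffOn hq, ⟨1 / 2, by norm_num, (h.pos _ (by norm_num)).ne'⟩, h.left, h.right,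
    fun x hx => ?_⟩
  rw [h.iteratedDerivWithin_two (Ioo_subset_Icc_self hx)]
  ring

/-- The energy of the ground state bounds below every `μ'` for which there is a solution that
vanishes at the end points and is positive somewhere. -/
lemma le_of_isSolution (h : IsGroundState q μ u p) {μ' : ℝ} {v r : ℝ → ℝ}
    (h' : IsSolution q μ' v r) (h0 : v 0 = 0) (h1 : v 1 = 0) {x : ℝ} (hx : x ∈ Icc (0 : ℝ) 1)
    (hvx : 0 < v x) : μ ≤ μ' := by
  by_contra! hlt
  obtain ⟨a, b, ha, hab, hb, hva, hvb, hpos⟩ :=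
    exists_nodal_interval h'.continuousOn h0 h1 hx hvx
  have hsub : Icc a b ⊆ Icc 0 1 := Icc_subset_Icc ha hb
  have hma : a ∈ Icc (0 : ℝ) 1 := hsub (left_mem_Icc.2 hab.le)
  have hmb : b ∈ Icc (0 : ℝ) 1 := hsub (right_mem_Icc.2 hab.le)
  have hW := fun y (hy : y ∈ Icc a b) =>
    (h'.hasDerivWithinAt_wronskian h.toIsSolution (hsub hy)).mono hsub
  -- If `μ' < μ`, the Wronskian decreases strictly on the nodal interval. Its end values `-r u` are
  -- nonpositive at `a` and nonnegative at `b`, a contradiction.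
  have hmono : StrictAntiOn (fun x => v x * p x - r x * u x) (Icc a b) := by
    refine strictAntiOn_of_hasDerivWithinAt_neg (convex_Icc a b)
      (fun y hy => (hW y hy).continuousWithinAt)
      (fun y hy => (hW y (interior_subset hy)).mono interior_subset) fun y hy => ?_
    rw [interior_Icc] at hy
    have := hpos y hy
    have := h.pos y ⟨ha.trans_lt hy.1, hy.2.trans_le hb⟩
    rw [sub_self, zero_sub, neg_mul, neg_lt_zero]
    exact mul_pos (sub_pos.2 hlt) (by positivity)
  have hend := hmono (left_mem_Icc.2 hab.le) (right_mem_Icc.2 hab.le) hab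
  have hra := nonneg_of_hasDerivWithinAt_of_left hab ((h'.hasDeriv a hma).mono hsub) hva
    fun y hy => (hpos y hy).le
  have hrb := nonpos_of_hasDerivWithinAt_of_right hab ((h'.hasDeriv b hmb).mono hsub) hvb
    fun y hy => (hpos y hy).le
  simp only [hva, hvb, zero_mul, zero_sub] at hend
  nlinarith [h.nonneg hma, h.nonneg hmb]

/-- The energy of the ground state is the smallest eigenvalue. -/
theorem smallestEigenvalue_eq (hq : Continuous q) (h : IsGroundState q μ u p) :
    smallestEigenvalue q = μ := by
  refine IsLeast.csInf_eq ⟨h.isEigenvalue hq, fun μ' hμ' => ?_⟩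
  obtain ⟨v, r, hv, ⟨x, hx, hne⟩, h0, h1⟩ := hμ'.exists_isSolution hq
  rcases hne.lt_or_gt with hneg | hpos
  · exact h.le_of_isSolution hv.neg (by simp [h0]) (by simp [h1]) hx (neg_pos.2 hneg)
  · exact h.le_of_isSolution hv h0 h1 hx hpos

/-- `u'' = (q - μ)u ≤ 0`, because `q ≤ 1 ≤ μ` and `u ≥ 0`. -/
lemma concaveOn (hq : IsPotential q) (hμ : 1 ≤ μ) (h : IsGroundState q μ u p) :
    ConcaveOn ℝ (Icc 0 1) u :=
  concaveOn_of_hasDerivWithinAt2_nonpos (convex_Icc 0 1) h.continuousOn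
    (fun x hx => (h.hasDeriv x (interior_subset hx)).mono interior_subset)
    (fun x hx => (h.hasDeriv' x (interior_subset hx)).mono interior_subset)
    fun x hx => mul_nonpos_of_nonpos_of_nonneg (by linarith [hq.le_one x])
      (h.nonneg (interior_subset hx))

/-- On the middle half of the interval the ground state is at least a quarter of its maximum. -/
lemma exists_bound (hq : IsPotential q) (hμ : 1 ≤ μ) (h : IsGroundState q μ u p) :
    ∃ M, 0 < M ∧ (∀ x ∈ Icc (0 : ℝ) 1, u x ≤ M) ∧
      ∀ x ∈ Icc (1 / 4 : ℝ) (3 / 4), M / 4 ≤ u x := by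
  obtain ⟨c, hc, hmax⟩ := isCompact_Icc.exists_isMaxOn ⟨0, by simp⟩ h.continuousOn
  have hM : 0 < u c := (h.pos (1 / 2) (by norm_num)).trans_le (hmax (by norm_num))
  have hc0 : 0 < c := lt_of_le_of_ne hc.1 (by rintro rfl; linarith [h.left])
  have hc1 : c < 1 := lt_of_le_of_ne hc.2 (by rintro rfl; linarith [h.right])
  refine ⟨u c, hM, fun x hx => hmax hx, fun x hx => ?_⟩
  have hconc := (h.concaveOn hq hμ).2
  -- The graph lies above the chords from the maximum at `c` to the end points; their relative
  -- heights `x/c` and `(1-x)/(1-c)` are at least `1/4` here.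
  rcases le_total x c with hxc | hcx
  · have hxc' : x / c ≤ 1 := (div_le_one hc0).2 hxc
    have hx0 : 0 ≤ x / c := div_nonneg (by linarith [hx.1]) hc0.le
    have := hconc (left_mem_Icc.2 zero_le_one) hc (sub_nonneg.2 hxc') hx0 (by ring)
    simp only [smul_eq_mul, h.left, mul_zero, zero_add, div_mul_cancel₀ _ hc0.ne'] at this
    refine le_trans ?_ this
    have : (1 / 4 : ℝ) ≤ x / c := by rw [le_div_iff₀ hc0]; linarith [hx.1]
    nlinarith
  · have h1c : 0 < 1 - c := by linarith
    have hxc' : (1 - x) / (1 - c) ≤ 1 := (div_le_one h1c).2 (by linarith)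
    have hx0 : 0 ≤ (1 - x) / (1 - c) := div_nonneg (by linarith [hx.2]) h1c.le
    have := hconc hc (right_mem_Icc.2 zero_le_one) hx0 (sub_nonneg.2 hxc') (by ring)
    simp only [smul_eq_mul, h.right, mul_zero, add_zero] at this
    rw [show (1 - x) / (1 - c) * c + (1 - (1 - x) / (1 - c)) * 1 = x by field_simp; ring] at this
    refine le_trans ?_ this
    have : (1 / 4 : ℝ) ≤ (1 - x) / (1 - c) := by rw [le_div_iff₀ h1c]; linarith [hx.2]
    nlinarith

end IsGroundState

/-! ### Growth of the eigenvalue with the potential -/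

/-- Raising the potential raises the smallest eigenvalue at least by a fixed multiple of the
integral of the increment over the middle half of the interval. -/
theorem IsPotential.le_smallestEigenvalue_sub {q₁ q₂ : ℝ → ℝ} (h₁ : IsPotential q₁)
    (h₂ : IsPotential q₂) (hle : ∀ x, q₁ x ≤ q₂ x) :
    (∫ x in (1 / 4 : ℝ)..(3 / 4), (q₂ x - q₁ x)) / 16 ≤
      smallestEigenvalue q₂ - smallestEigenvalue q₁ := by
  obtain ⟨μ₁, hμ₁, u₁, p₁, hu₁⟩ := h₁.exists_isGroundState
  obtain ⟨μ₂, hμ₂, u₂, p₂, hu₂⟩ := h₂.exists_isGroundState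
  rw [hu₁.smallestEigenvalue_eq h₁.continuous, hu₂.smallestEigenvalue_eq h₂.continuous]
  have hpi : (1 : ℝ) ≤ Real.pi ^ 2 := by nlinarith [Real.pi_gt_three]
  obtain ⟨M₁, hM₁, hle₁, hge₁⟩ := hu₁.exists_bound h₁ (hpi.trans hμ₁)
  obtain ⟨M₂, hM₂, hle₂, hge₂⟩ := hu₂.exists_bound h₂ (hpi.trans hμ₂)
  set w : ℝ → ℝ := fun x => u₁ x * u₂ x with hw
  set g : ℝ → ℝ := fun x => q₂ x - q₁ x with hg
  have hgc : Continuous g := h₂.continuous.sub h₁.continuous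
  have hg0 : ∀ x, 0 ≤ g x := fun x => sub_nonneg.2 (hle x)
  have hwc : ContinuousOn w (Icc 0 1) := hu₁.continuousOn.mul hu₂.continuousOn
  have hw0 : ∀ x ∈ Icc (0 : ℝ) 1, 0 ≤ w x := fun x hx =>
    mul_nonneg (hu₁.nonneg hx) (hu₂.nonneg hx)
  have hwi : IntervalIntegrable w volume 0 1 := by
    apply ContinuousOn.intervalIntegrable; rwa [uIcc_of_le zero_le_one]
  have hgwc : ContinuousOn (fun x => g x * w x) (Icc 0 1) := hgc.continuousOn.mul hwc
  have hgwi : IntervalIntegrable (fun x => g x * w x) volume 0 1 := by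
    apply ContinuousOn.intervalIntegrable; rwa [uIcc_of_le zero_le_one]
  -- The Wronskian vanishes at both ends, so its derivative integrates to zero.
  have hzero : ∫ x in (0 : ℝ)..1, (g x * w x - (μ₂ - μ₁) * w x) = 0 := by
    have hW := fun x hx => hu₁.hasDerivWithinAt_wronskian hu₂.toIsSolution (x := x) hx
    have := intervalIntegral.integral_eq_sub_of_hasDerivAt_of_le
      (f := fun x => u₁ x * p₂ x - p₁ x * u₂ x) (f' := fun x => g x * w x - (μ₂ - μ₁) * w x)
      zero_le_one (fun x hx => (hW x hx).continuousWithinAt)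
      (fun x hx => ((hW x (Ioo_subset_Icc_self hx)).hasDerivAt
        (Icc_mem_nhds hx.1 hx.2)).congr_deriv (by simp only [hg, hw]; ring))
      (hgwi.sub (hwi.const_mul _))
    simpa [hu₁.left, hu₁.right, hu₂.left, hu₂.right] using this
  rw [intervalIntegral.integral_sub hgwi (hwi.const_mul _), intervalIntegral.integral_const_mul,
    sub_eq_zero] at hzero
  have hsub : Icc (1 / 4 : ℝ) (3 / 4) ⊆ Icc 0 1 := Icc_subset_Icc (by norm_num) (by norm_num)
  have hlow : (∫ x in (1 / 4 : ℝ)..(3 / 4), g x) * (M₁ * M₂ / 16) ≤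
      ∫ x in (0 : ℝ)..1, g x * w x := by
    calc _ = ∫ x in (1 / 4 : ℝ)..(3 / 4), g x * (M₁ * M₂ / 16) := by
          rw [intervalIntegral.integral_mul_const]
      _ ≤ ∫ x in (1 / 4 : ℝ)..(3 / 4), g x * w x := by
          refine intervalIntegral.integral_mono_on (by norm_num)
            ((hgc.mul continuous_const).intervalIntegrable _ _)
            (ContinuousOn.intervalIntegrable ?_) fun x hx => ?_
          · rw [uIcc_of_le (by norm_num)]; exact hgwc.mono hsub
          · refine mul_le_mul_of_nonneg_left ?_ (hg0 x)
            calc M₁ * M₂ / 16 = (M₁ / 4) * (M₂ / 4) := by ring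
              _ ≤ w x := mul_le_mul (hge₁ x hx) (hge₂ x hx) (by positivity)
                (hu₁.nonneg (hsub hx))
      _ ≤ _ := by
          refine intervalIntegral.integral_mono_interval (by norm_num) (by norm_num) (by norm_num)
            ?_ hgwi
          refine (ae_restrict_iff' measurableSet_Ioc).2 (Filter.Eventually.of_forall fun x hx => ?_)
          exact mul_nonneg (hg0 x) (hw0 x (Ioc_subset_Icc_self hx))
  have hup : ∫ x in (0 : ℝ)..1, w x ≤ M₁ * M₂ := by
    calc _ ≤ ∫ x in (0 : ℝ)..1, M₁ * M₂ := by
          refine intervalIntegral.integral_mono_on zero_le_one hwi (by simp) fun x hx => ?_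
          exact mul_le_mul (hle₁ x hx) (hle₂ x hx) (hu₂.nonneg hx) hM₁.le
      _ = _ := by simp
  have hwpos : 0 < ∫ x in (0 : ℝ)..1, w x := by
    refine intervalIntegral.intervalIntegral_pos_of_pos_on hwi (fun x hx => ?_) zero_lt_one
    exact mul_pos (hu₁.pos x hx) (hu₂.pos x hx)
  have hG : 0 ≤ ∫ x in (1 / 4 : ℝ)..(3 / 4), g x :=
    intervalIntegral.integral_nonneg (by norm_num) fun x _ => hg0 x
  have hMM : 0 < M₁ * M₂ := mul_pos hM₁ hM₂
  -- The sign is needed to multiply the upper bound `hup` by `μ₂ - μ₁`; the unknown scale `M₁ * M₂`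
  -- then cancels.
  have hdiff : 0 ≤ μ₂ - μ₁ := by
    by_contra! hneg
    have := mul_neg_of_neg_of_pos hneg hwpos
    have : 0 ≤ (∫ x in (1 / 4 : ℝ)..(3 / 4), g x) * (M₁ * M₂ / 16) := by positivity
    linarith
  have : (∫ x in (1 / 4 : ℝ)..(3 / 4), g x) / 16 * (M₁ * M₂) ≤ (μ₂ - μ₁) * (M₁ * M₂) := by
    calc _ = (∫ x in (1 / 4 : ℝ)..(3 / 4), g x) * (M₁ * M₂ / 16) := by ring
      _ ≤ (μ₂ - μ₁) * ∫ x in (0 : ℝ)..1, w x := hzero ▸ hlow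
      _ ≤ _ := mul_le_mul_of_nonneg_left hup hdiff
  exact le_of_mul_le_mul_right this hMM

/-! ### Potentials made of disjoint bumps -/

/-- A nonnegative `C²` function supported in `(0,1)` whose derivatives up to order two are bounded
by one. -/
structure IsBump (ψ : ℝ → ℝ) : Prop where
  contDiff : ContDiff ℝ 2 ψ
  nonneg : ∀ x, 0 ≤ ψ x
  eq_zero : ∀ i : ℕ, ∀ x ∉ Ioo (0 : ℝ) 1, iteratedDeriv i ψ x = 0
  abs_iteratedDeriv_le : ∀ i ≤ 2, ∀ x, |iteratedDeriv i ψ x| ≤ 1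
  integral_pos : 0 < ∫ x in (0 : ℝ)..1, ψ x

/-- A smooth bump supported in `[1/4,3/4]`, divided by a common bound of its derivatives of order at
most two. -/
lemma exists_isBump : ∃ ψ, IsBump ψ := by
  let f : ContDiffBump (1 / 2 : ℝ) := ⟨1 / 8, 1 / 4, by norm_num, by norm_num⟩
  have hf : ContDiff ℝ 2 f := f.contDiff
  have hsupp : ∀ i : ℕ, ∀ x ∉ Ioo (0 : ℝ) 1, iteratedDeriv i f x = 0 := by
    intro i x hx
    have h1 : x ∉ tsupport f := by
      rw [f.tsupport_eq, Metric.mem_closedBall, Real.dist_eq]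
      change ¬ |x - 1 / 2| ≤ 1 / 4
      rw [abs_le]
      rintro ⟨h1, h2⟩
      exact hx ⟨by linarith, by linarith⟩
    have h2 : iteratedFDeriv ℝ i f x = 0 := by
      by_contra hne
      exact h1 (support_iteratedFDeriv_subset i hne)
    rw [iteratedDeriv, h2]
    simp
  have hbound : ∀ i ≤ 2, ∃ C, ∀ x, |iteratedDeriv i f x| ≤ C := by
    intro i hi
    have hc : Continuous (iteratedDeriv i f) :=
      hf.continuous_iteratedDeriv i (by exact_mod_cast hi)
    obtain ⟨C, hC⟩ := isCompact_Icc.exists_bound_of_continuousOn (s := Icc (0 : ℝ) 1)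
      hc.continuousOn
    refine ⟨max C 0, fun x => ?_⟩
    by_cases hx : x ∈ Ioo (0 : ℝ) 1
    · exact (hC x (Ioo_subset_Icc_self hx)).trans (le_max_left _ _)
    · simp [hsupp i x hx]
  choose! C hC using hbound
  obtain ⟨D, hD1, hD⟩ : ∃ D : ℝ, 0 < D ∧ ∀ i ≤ 2, C i ≤ D := by
    refine ⟨|C 0| + |C 1| + |C 2| + 1, by positivity, fun i hi => ?_⟩
    have := abs_nonneg (C 0)
    have := abs_nonneg (C 1)
    have := abs_nonneg (C 2)
    interval_cases i
    · linarith [le_abs_self (C 0)]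
    · linarith [le_abs_self (C 1)]
    · linarith [le_abs_self (C 2)]
  have hder : ∀ i x, iteratedDeriv i (fun x => D⁻¹ * f x) x = D⁻¹ * iteratedDeriv i f x :=
    fun i x => by rw [iteratedDeriv_const_mul_field]
  refine ⟨fun x => D⁻¹ * f x, contDiff_const.mul hf, fun x => mul_nonneg (by positivity) f.nonneg,
    fun i x hx => by rw [hder, hsupp i x hx, mul_zero], fun i hi x => ?_, ?_⟩
  · rw [hder, abs_mul, abs_of_pos (inv_pos.2 hD1), inv_mul_le_iff₀ hD1, mul_one]
    exact (hC i hi x).trans (hD i hi)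
  · rw [intervalIntegral.integral_const_mul]
    refine mul_pos (by positivity) ?_
    refine intervalIntegral.integral_pos zero_lt_one f.continuous.continuousOn
      (fun x _ => f.nonneg) ⟨1 / 2, by norm_num, ?_⟩
    exact f.pos_of_mem_ball (Metric.mem_ball_self f.rOut_pos)

/-- The `k`-th of `m` disjoint scaled copies of `ψ` in `[1/4,3/4]`. -/
noncomputable def bump (ψ : ℝ → ℝ) (m : ℕ) (k : ℕ) (x : ℝ) : ℝ :=
  ((2 * m : ℝ) ^ 2)⁻¹ * ψ (2 * m * x - (m / 2 + k))

/-- The potential made up of the bumps with index in `s`. -/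
noncomputable def bumpSum (ψ : ℝ → ℝ) {m : ℕ} (s : Finset (Fin m)) (x : ℝ) : ℝ :=
  ∑ k ∈ s, bump ψ m k x

namespace IsBump

variable {ψ : ℝ → ℝ} {m : ℕ}

lemma contDiff_bump (hψ : IsBump ψ) (k : ℕ) : ContDiff ℝ 2 (bump ψ m k) := by
  have := hψ.contDiff
  unfold bump
  fun_prop

lemma contDiff_bumpSum (hψ : IsBump ψ) (s : Finset (Fin m)) : ContDiff ℝ 2 (bumpSum ψ s) :=
  ContDiff.sum fun k _ => hψ.contDiff_bump k

lemma bump_nonneg (hψ : IsBump ψ) (k : ℕ) (x : ℝ) : 0 ≤ bump ψ m k x :=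
  mul_nonneg (by positivity) (hψ.nonneg _)

lemma iteratedDeriv_bump (hψ : IsBump ψ) {i : ℕ} (hi : i ≤ 2) (k : ℕ) (x : ℝ) :
    iteratedDeriv i (bump ψ m k) x =
      ((2 * m : ℝ) ^ 2)⁻¹ * ((2 * m : ℝ) ^ i *
        iteratedDeriv i ψ (2 * m * x - (m / 2 + k))) := by
  have h1 : ContDiff ℝ i (fun y => ψ (y - (m / 2 + k))) :=
    (hψ.contDiff.of_le (by exact_mod_cast hi)).comp (contDiff_id.sub contDiff_const)
  have h2 := congrFun (iteratedDeriv_comp_const_mul h1 (2 * m : ℝ)) x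
  unfold bump
  rw [iteratedDeriv_const_mul_field, h2, iteratedDeriv_comp_sub_const]

/-- The amplitude `(2m)⁻²` pays for the at most two factors `2m` of the chain rule. -/
lemma abs_iteratedDeriv_bump_le (hψ : IsBump ψ) (hm : 0 < m) {i : ℕ} (hi : i ≤ 2) (k : ℕ) (x : ℝ) :
    |iteratedDeriv i (bump ψ m k) x| ≤ 1 := by
  have hc : (1 : ℝ) ≤ 2 * m := by
    have : (1 : ℝ) ≤ m := by exact_mod_cast hm
    linarith
  rw [hψ.iteratedDeriv_bump hi, abs_mul, abs_mul, abs_of_nonneg (by positivity),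
    abs_of_nonneg (by positivity), inv_mul_le_iff₀ (by positivity), mul_one]
  calc _ ≤ (2 * m : ℝ) ^ i * 1 := by gcongr; exact hψ.abs_iteratedDeriv_le i hi _
    _ ≤ (2 * m : ℝ) ^ 2 := by rw [mul_one]; exact pow_le_pow_right₀ hc hi

/-- Distinct bumps have disjoint supports, also for their derivatives. -/
lemma eq_of_iteratedDeriv_bump_ne_zero (hψ : IsBump ψ)
    {i j : ℕ} (hi : i ≤ 2) (hj : j ≤ 2) {k l : ℕ} {x : ℝ}
    (hk : iteratedDeriv i (bump ψ m k) x ≠ 0) (hl : iteratedDeriv j (bump ψ m l) x ≠ 0) :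
    k = l := by
  have key : ∀ {i k : ℕ}, i ≤ 2 → iteratedDeriv i (bump ψ m k) x ≠ 0 →
      (k : ℝ) < 2 * m * x - m / 2 ∧ 2 * m * x - m / 2 < k + 1 := by
    intro i k hi h
    rw [hψ.iteratedDeriv_bump hi] at h
    by_contra hx
    refine h ?_
    rw [hψ.eq_zero i _ fun h' => hx ⟨by linarith [h'.1], by linarith [h'.2]⟩]
    ring
  obtain ⟨h1, h2⟩ := key hi hk
  obtain ⟨h3, h4⟩ := key hj hl
  have h5 : (k : ℝ) < l + 1 := by linarith
  have h6 : (l : ℝ) < k + 1 := by linarith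
  norm_cast at h5 h6
  omega

/-- At each point at most one summand is nonzero, so the bound for a single bump survives summation.
-/
lemma abs_iteratedDeriv_bumpSum_le (hψ : IsBump ψ)
    (hm : 0 < m) (s : Finset (Fin m)) {i : ℕ} (hi : i ≤ 2)
    (x : ℝ) : |iteratedDeriv i (bumpSum ψ s) x| ≤ 1 := by
  have h : iteratedDeriv i (bumpSum ψ s) x = ∑ k ∈ s, iteratedDeriv i (bump ψ m k) x :=
    iteratedDeriv_fun_sum fun k _ =>
      ((hψ.contDiff_bump k).of_le (by exact_mod_cast hi)).contDiffAt
  rw [h]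
  by_cases hex : ∃ k ∈ s, iteratedDeriv i (bump ψ m k) x ≠ 0
  · obtain ⟨k, hks, hk⟩ := hex
    rw [Finset.sum_eq_single_of_mem k hks fun l _ hlk => ?_]
    · exact hψ.abs_iteratedDeriv_bump_le hm hi k x
    · by_contra hl
      exact hlk (Fin.ext (hψ.eq_of_iteratedDeriv_bump_ne_zero hi hi hl hk))
  · push Not at hex
    rw [Finset.sum_eq_zero hex]
    simp

lemma isPotential_bumpSum (hψ : IsBump ψ)
    (hm : 0 < m) (s : Finset (Fin m)) : IsPotential (bumpSum ψ s) where
  continuous := (hψ.contDiff_bumpSum s).continuous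
  nonneg x := Finset.sum_nonneg fun k _ => hψ.bump_nonneg k x
  le_one x := by
    simpa using (le_abs_self _).trans (hψ.abs_iteratedDeriv_bumpSum_le hm s (Nat.zero_le 2) x)

lemma bumpSum_mem_Q (hψ : IsBump ψ) (hm : 0 < m) (s : Finset (Fin m)) : bumpSum ψ s ∈ Q := by
  have hp := hψ.isPotential_bumpSum hm s
  refine ⟨fun x _ => ⟨hp.nonneg x, hp.le_one x⟩, (hψ.contDiff_bumpSum s).contDiffOn,
    fun i hi x hx => ?_⟩
  rw [iteratedDerivWithin_eq_iteratedDeriv (uniqueDiffOn_Icc zero_lt_one)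
    ((hψ.contDiff_bumpSum s).of_le (by exact_mod_cast hi)).contDiffAt hx]
  exact hψ.abs_iteratedDeriv_bumpSum_le hm s hi x

lemma card_filter_bump_ne_zero_le (hψ : IsBump ψ) (x : ℝ) :
    (Finset.univ.filter fun k : Fin m => bump ψ m k x ≠ 0).card ≤ 1 := by
  refine Finset.card_le_one.2 fun k hk l hl => Fin.ext ?_
  simp only [Finset.mem_filter, Finset.mem_univ, true_and] at hk hl
  exact hψ.eq_of_iteratedDeriv_bump_ne_zero (Nat.zero_le 2) (Nat.zero_le 2) (x := x)
    (by simpa using hk) (by simpa using hl)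

/-- Amplitude `(2m)⁻²` times the factor `(2m)⁻¹` of the substitution, which maps `[1/4,3/4]` onto
`[-k, m-k] ⊇ [0,1]`. -/
lemma le_integral_bump (hψ : IsBump ψ) (hm : 0 < m) (k : Fin m) :
    ((2 * m : ℝ) ^ 3)⁻¹ * ∫ x in (0 : ℝ)..1, ψ x ≤ ∫ x in (1 / 4 : ℝ)..(3 / 4), bump ψ m k x := by
  have hm' : (0 : ℝ) < m := by exact_mod_cast hm
  have hk : (k : ℝ) + 1 ≤ m := by exact_mod_cast k.2
  unfold bump
  rw [intervalIntegral.integral_const_mul,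
    intervalIntegral.integral_comp_mul_sub ψ (by positivity) _, smul_eq_mul,
    show 2 * (m : ℝ) * (1 / 4) - (m / 2 + k) = -k by ring,
    show 2 * (m : ℝ) * (3 / 4) - (m / 2 + k) = m - k by ring, ← mul_assoc, ← mul_inv,
    ← pow_succ]
  refine mul_le_mul_of_nonneg_left ?_ (by positivity)
  refine intervalIntegral.integral_mono_interval (by simp) zero_le_one (by linarith)
    (Filter.Eventually.of_forall hψ.nonneg) (hψ.contDiff.continuous.intervalIntegrable _ _)

/-- Adding bumps raises the smallest eigenvalue in proportion to their number. -/
lemma le_smallestEigenvalue_bumpSum_sub (hψ : IsBump ψ)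
    (hm : 0 < m) {s t : Finset (Fin m)} (hst : s ⊆ t) :
    ((t \ s).card : ℝ) * ((∫ x in (0 : ℝ)..1, ψ x) / 128 / m ^ 3) ≤
      smallestEigenvalue (bumpSum ψ t) - smallestEigenvalue (bumpSum ψ s) := by
  have hm' : (0 : ℝ) < m := by exact_mod_cast hm
  have hsub : ∀ x, bumpSum ψ t x - bumpSum ψ s x = ∑ k ∈ t \ s, bump ψ m k x := fun x => by
    rw [bumpSum, bumpSum, ← Finset.sum_sdiff hst, add_sub_cancel_right]
  refine le_trans ?_ ((hψ.isPotential_bumpSum hm s).le_smallestEigenvalue_sub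
    (hψ.isPotential_bumpSum hm t) fun x => ?_)
  · simp only [hsub]
    rw [intervalIntegral.integral_finsetSum (f := fun (k : Fin m) x => bump ψ m k x) fun k _ =>
      (hψ.contDiff_bump k).continuous.intervalIntegrable _ _]
    -- The constant is `128 = 16 · 2³`: `16` from the eigenvalue estimate, `2³` from `(2m)³`.
    have := Finset.card_nsmul_le_sum (t \ s) _ _ fun k _ => hψ.le_integral_bump hm k
    rw [nsmul_eq_mul] at this
    rw [le_div_iff₀ (by norm_num)]
    refine le_trans (le_of_eq ?_) this
    field_simp
    ring
  · rw [← sub_nonneg, hsub]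
    exact Finset.sum_nonneg fun k _ => hψ.bump_nonneg k x

end IsBump

/-! ### What an adaptive algorithm can notice -/

namespace Algorithm

variable {A : Algorithm} {q q' : ℝ → ℝ}

lemma numSamples_eq_coe_iff {n : ℕ} : A.numSamples q = n ↔
    A.halt (A.data q n) ∧ ∀ k < n, ¬ A.halt (A.data q k) := by
  constructor
  · intro h
    have hne : {m : ℕ∞ | ∃ k : ℕ, m = k ∧ A.halt (A.data q k)}.Nonempty := by
      by_contra hemp
      rw [not_nonempty_iff_eq_empty] at hemp
      rw [numSamples, hemp, sInf_empty] at h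
      exact ENat.natCast_ne_top n h.symm
    have hmem := csInf_mem hne
    rw [numSamples] at h
    rw [h] at hmem
    obtain ⟨k, hk, hhalt⟩ := hmem
    rw [Nat.cast_inj] at hk
    subst hk
    refine ⟨hhalt, fun k hk hhalt' => ?_⟩
    have : A.numSamples q ≤ k := sInf_le ⟨k, rfl, hhalt'⟩
    rw [numSamples, h, Nat.cast_le] at this
    omega
  · rintro ⟨h1, h2⟩
    refine IsLeast.csInf_eq ⟨⟨n, rfl, h1⟩, ?_⟩
    rintro _ ⟨k, rfl, hk⟩
    rw [Nat.cast_le]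
    by_contra! hlt
    exact h2 k hlt hk

/-- The data depend only on the values at the sample points. -/
lemma data_congr {n : ℕ} (h : ∀ i < n, q' (A.samplePoint q i) = q (A.samplePoint q i)) :
    ∀ j ≤ n, A.data q' j = A.data q j := by
  intro j
  induction j with
  | zero => intro _; rfl
  | succ j ih =>
    intro hj
    have h1 := ih (by omega)
    have h2 := h j (by omega)
    rw [samplePoint] at h2
    rw [data, data, h1, h2]

lemma numSamples_congr (hfin : A.numSamples q ≠ ⊤)
    (h : ∀ i < (A.numSamples q).toNat, q' (A.samplePoint q i) = q (A.samplePoint q i)) :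
    A.numSamples q' = A.numSamples q := by
  obtain ⟨n, hn⟩ := ENat.ne_top_iff_exists.1 hfin
  rw [← hn, ENat.toNat_natCast] at h
  rw [← hn, numSamples_eq_coe_iff]
  have hd := data_congr h
  obtain ⟨h1, h2⟩ := numSamples_eq_coe_iff.1 hn.symm
  refine ⟨by rwa [hd n le_rfl], fun k hk => ?_⟩
  rw [hd k hk.le]
  exact h2 k hk

lemma result_congr (hfin : A.numSamples q ≠ ⊤)
    (h : ∀ i < (A.numSamples q).toNat, q' (A.samplePoint q i) = q (A.samplePoint q i)) :
    A.result q' = A.result q := by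
  rw [result, result, numSamples_congr hfin h, data_congr h _ le_rfl]

open Classical in
/-- The indices of the bumps that the algorithm cannot notice when applied to `bumpSum ψ s`;
empty if the algorithm does not stop. -/
noncomputable def freeSet (A : Algorithm) (ψ : ℝ → ℝ) {m : ℕ} (s : Finset (Fin m)) :
    Finset (Fin m) :=
  Finset.univ.filter fun k => A.numSamples (bumpSum ψ s) ≠ ⊤ ∧
    ∀ i < (A.numSamples (bumpSum ψ s)).toNat, bump ψ m k (A.samplePoint (bumpSum ψ s) i) = 0

variable {ψ : ℝ → ℝ} {m : ℕ} {s t : Finset (Fin m)}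

lemma mem_freeSet {k : Fin m} : k ∈ A.freeSet ψ s ↔ A.numSamples (bumpSum ψ s) ≠ ⊤ ∧
    ∀ i < (A.numSamples (bumpSum ψ s)).toNat, bump ψ m k (A.samplePoint (bumpSum ψ s) i) = 0 := by
  simp [freeSet]

/-- Changing bumps that the algorithm cannot notice does not change the sampled values. -/
lemma bumpSum_eq_of_free (h : ∀ k ∉ A.freeSet ψ s, k ∈ t ↔ k ∈ s) {i : ℕ}
    (hi : i < (A.numSamples (bumpSum ψ s)).toNat) :
    bumpSum ψ t (A.samplePoint (bumpSum ψ s) i) = bumpSum ψ s (A.samplePoint (bumpSum ψ s) i) := by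
  set x := A.samplePoint (bumpSum ψ s) i with hx
  have key : ∀ r : Finset (Fin m),
      bumpSum ψ r x = ∑ k ∈ r.filter fun k => k ∉ A.freeSet ψ s, bump ψ m k x := by
    intro r
    rw [bumpSum, Finset.sum_filter_of_ne]
    intro k _ hk hfree
    exact hk ((mem_freeSet.1 hfree).2 i hi)
  rw [key, key]
  congr 1
  ext k
  simp only [Finset.mem_filter]
  constructor
  · rintro ⟨h1, h2⟩; exact ⟨(h k h2).1 h1, h2⟩
  · rintro ⟨h1, h2⟩; exact ⟨(h k h2).2 h1, h2⟩

lemma result_eq_of_free (hfin : A.numSamples (bumpSum ψ s) ≠ ⊤)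
    (h : ∀ k ∉ A.freeSet ψ s, k ∈ t ↔ k ∈ s) :
    A.result (bumpSum ψ t) = A.result (bumpSum ψ s) :=
  result_congr hfin fun _ hi => bumpSum_eq_of_free h hi

/-- The free set depends only on the run of the algorithm. Hence toggling a free bump is an
involution on the sets for which that bump is free. -/
lemma freeSet_eq_of_free (hfin : A.numSamples (bumpSum ψ s) ≠ ⊤)
    (h : ∀ k ∉ A.freeSet ψ s, k ∈ t ↔ k ∈ s) : A.freeSet ψ t = A.freeSet ψ s := by
  have hagree := fun i hi => bumpSum_eq_of_free (i := i) h hi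
  ext k
  rw [mem_freeSet, mem_freeSet, numSamples_congr hfin hagree]
  refine and_congr_right fun _ => forall₂_congr fun i hi => ?_
  rw [samplePoint, samplePoint, data_congr hagree i hi.le]

/-- Each sample notices at most one bump. -/
lemma le_card_freeSet_add (hψ : IsBump ψ) :
    (m : ℕ∞) ≤ (A.freeSet ψ s).card + A.numSamples (bumpSum ψ s) := by
  by_cases hfin : A.numSamples (bumpSum ψ s) = ⊤
  · simp [hfin]
  obtain ⟨n, hn⟩ := ENat.ne_top_iff_exists.1 hfin
  rw [← hn]
  have hsub : (A.freeSet ψ s)ᶜ ⊆ (Finset.range n).biUnion fun i =>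
      Finset.univ.filter fun k : Fin m => bump ψ m k (A.samplePoint (bumpSum ψ s) i) ≠ 0 := by
    intro k hk
    rw [Finset.mem_compl, mem_freeSet] at hk
    push Not at hk
    obtain ⟨i, hi, hne⟩ := hk hfin
    rw [← hn, ENat.toNat_natCast] at hi
    simp only [Finset.mem_biUnion, Finset.mem_range, Finset.mem_filter, Finset.mem_univ, true_and]
    exact ⟨i, hi, hne⟩
  have hcard := (Finset.card_le_card hsub).trans (Finset.card_biUnion_le_card_mul _ _ 1
    fun i _ => hψ.card_filter_bump_ne_zero_le _)
  rw [Finset.card_compl, Fintype.card_fin, Finset.card_range, mul_one] at hcard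
  norm_cast
  omega

end Algorithm

/-! ### Mean square error on the cube -/

open scoped symmDiff in
/-- Lower bound for the mean square error on the cube of all `s : Finset ι` of an approximation
`φ` of a function `Λ` with increments at least `δ`, if `φ` and `F` are invariant under a change
of a coordinate in `F s`. -/
theorem sum_card_le_sum_sq_sub {ι : Type*} [Fintype ι] [DecidableEq ι]
    {F : Finset ι → Finset ι} {φ Λ : Finset ι → ℝ} {δ : ℝ} (hδ : 0 ≤ δ)
    (hF : ∀ s, ∀ k ∈ F s, F (s ∆ {k}) = F s) (hφ : ∀ s, ∀ k ∈ F s, φ (s ∆ {k}) = φ s)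
    (hΛ : ∀ s, ∀ k ∉ s, δ ≤ Λ (insert k s) - Λ s) :
    δ ^ 2 / 4 * ∑ s, ((F s).card : ℝ) ≤ ∑ s, (Λ s - φ s) ^ 2 := by
  set sg : ι → Finset ι → ℝ := fun k s => if k ∈ s then 1 else -1 with hsg
  have hsq : ∀ k s, sg k s * sg k s = 1 := fun k s => by simp only [hsg]; split_ifs <;> norm_num
  have hflip : ∀ k s, sg k (s ∆ {k}) = -sg k s := fun k s => by
    simp only [hsg, Finset.mem_symmDiff, Finset.mem_singleton]
    by_cases h : k ∈ s <;> simp [h]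
  have hkeep : ∀ k l s, l ≠ k → sg l (s ∆ {k}) = sg l s := fun k l s h => by
    simp only [hsg, Finset.mem_symmDiff, Finset.mem_singleton]
    by_cases h' : l ∈ s <;> simp [h, h']
  have hinv : ∀ (k : ι) (s : Finset ι), s ∆ {k} ∆ {k} = s := fun k s =>
    symmDiff_symmDiff_cancel_right _ _
  set Z : Finset ι → ℝ := fun s => ∑ k ∈ F s, sg k s with hZ
  have hswap : ∀ f : ι → Finset ι → ℝ, ∑ s, ∑ k ∈ F s, f k s =
      ∑ k, ∑ s with k ∈ F s, f k s := fun f => by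
    refine Finset.sum_comm' ?_
    simp
  -- reindexing by the change of the coordinate `k`
  have hre : ∀ (k : ι) (f : Finset ι → ℝ), ∑ s with k ∈ F s, f (s ∆ {k}) =
      ∑ s with k ∈ F s, f s := fun k f => by
    refine Finset.sum_nbij' (fun s => s ∆ {k}) (fun s => s ∆ {k}) ?_ ?_ ?_ ?_ ?_
    · intro s hs
      simp only [Finset.mem_filter, Finset.mem_univ, true_and] at hs ⊢
      rwa [hF s k hs]
    · intro s hs
      simp only [Finset.mem_filter, Finset.mem_univ, true_and] at hs ⊢
      rwa [hF s k hs]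
    · intro s _; exact hinv k s
    · intro s _; exact hinv k s
    · intro s _; rfl
  -- Orthogonality of the signs: toggling a free `k` reverses the cross terms in `sg k * Z`, so `s`
  -- and `s ∆ {k}` together contribute `2`.
  have hZZ : ∑ s, Z s ^ 2 = ∑ s, ((F s).card : ℝ) := by
    have h1 : ∀ s, Z s ^ 2 = ∑ k ∈ F s, sg k s * Z s := fun s => by
      rw [sq, hZ, Finset.sum_mul]
    have h2 : ∀ k s, k ∈ F s → sg k s * Z s + sg k (s ∆ {k}) * Z (s ∆ {k}) = 2 := by
      intro k s hk
      have h3 : Z (s ∆ {k}) = Z s - 2 * sg k s := by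
        simp only [hZ]
        rw [hF s k hk, ← Finset.add_sum_erase _ _ hk, ← Finset.add_sum_erase _ _ hk, hflip,
          Finset.sum_congr rfl fun l hl => hkeep k l s (Finset.ne_of_mem_erase hl)]
        ring
      rw [h3, hflip]
      linear_combination 2 * hsq k s
    have h4 : ∀ k, ∑ s with k ∈ F s, sg k s * Z s = ∑ s with k ∈ F s, (1 : ℝ) := by
      intro k
      have h5 := hre k fun s => sg k s * Z s
      have h6 : ∑ s with k ∈ F s, (sg k s * Z s + sg k (s ∆ {k}) * Z (s ∆ {k})) =
          ∑ s with k ∈ F s, (2 : ℝ) :=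
        Finset.sum_congr rfl fun s hs => h2 k s (by simpa using hs)
      rw [Finset.sum_add_distrib, h5] at h6
      simp only [Finset.sum_const, nsmul_eq_mul] at h6 ⊢
      linarith
    rw [Finset.sum_congr rfl fun s _ => h1 s, hswap, Finset.sum_congr rfl fun k _ => h4 k,
      ← hswap fun _ _ => 1]
    simp
  have hZΛ : δ / 2 * ∑ s, ((F s).card : ℝ) ≤ ∑ s, Z s * (Λ s - φ s) := by
    have h1 : ∀ s, Z s * (Λ s - φ s) = ∑ k ∈ F s, sg k s * (Λ s - φ s) := fun s => by
      rw [hZ, Finset.sum_mul]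
    -- The toggle fixes `φ`, which cancels, and leaves an increment of `Λ`.
    have h2 : ∀ k s, k ∈ F s → δ ≤ sg k s * (Λ s - φ s) +
        sg k (s ∆ {k}) * (Λ (s ∆ {k}) - φ (s ∆ {k})) := by
      intro k s hk
      rw [hflip, hφ s k hk]
      by_cases h : k ∈ s
      · have h3 : s ∆ {k} = s.erase k := by
          ext l; by_cases hl : l = k <;> simp [Finset.mem_symmDiff, hl, h]
        have h4 := hΛ (s.erase k) k (Finset.notMem_erase k s)
        rw [Finset.insert_erase h] at h4
        simp only [hsg, h, if_true, h3]
        linarith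
      · have h3 : s ∆ {k} = insert k s := by
          ext l; by_cases hl : l = k <;> simp [Finset.mem_symmDiff, hl, h]
        have h4 := hΛ s k h
        simp only [hsg, h, if_false, h3]
        linarith
    have h4 : ∀ k, ∑ s with k ∈ F s, δ / 2 ≤ ∑ s with k ∈ F s, sg k s * (Λ s - φ s) := by
      intro k
      have h5 := hre k fun s => sg k s * (Λ s - φ s)
      have h6 : ∑ s with k ∈ F s, δ ≤ ∑ s with k ∈ F s, (sg k s * (Λ s - φ s) +
          sg k (s ∆ {k}) * (Λ (s ∆ {k}) - φ (s ∆ {k}))) :=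
        Finset.sum_le_sum fun s hs => h2 k s (by simpa using hs)
      rw [Finset.sum_add_distrib, h5] at h6
      rw [← Finset.sum_div]
      linarith
    rw [Finset.sum_congr rfl fun s _ => h1 s, hswap]
    refine le_trans (le_of_eq ?_) (Finset.sum_le_sum fun k _ => h4 k)
    rw [← hswap fun _ _ => δ / 2]
    simp [Finset.mul_sum, mul_comm]
  -- Compare the error with its guessed random part `δ/2 * Z`; expanding the square gives `δ²/2 -
  -- δ²/4 = δ²/4`.
  have hpos : 0 ≤ ∑ s, (Λ s - φ s - δ / 2 * Z s) ^ 2 := Finset.sum_nonneg fun s _ => sq_nonneg _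
  have hexp : ∑ s, (Λ s - φ s - δ / 2 * Z s) ^ 2 = ∑ s, (Λ s - φ s) ^ 2 -
      δ * ∑ s, Z s * (Λ s - φ s) + δ ^ 2 / 4 * ∑ s, Z s ^ 2 := by
    rw [Finset.mul_sum, Finset.mul_sum, ← Finset.sum_sub_distrib, ← Finset.sum_add_distrib]
    exact Finset.sum_congr rfl fun s _ => by ring
  rw [hexp, hZZ] at hpos
  nlinarith [mul_le_mul_of_nonneg_left hZΛ hδ]

/-! ### Lower bounds for both kinds of algorithm -/

variable {ψ : ℝ → ℝ}

/-- A deterministic algorithm with at most `n` samples has error at least of order `n⁻²`. -/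
lemma IsBump.le_of_worstError_le (hψ : IsBump ψ) {A : Algorithm} {n : ℕ} {ε : ℝ} (hε : 0 ≤ ε)
    (hn : A.worstNumSamples ≤ n) (hA : A.worstError ≤ ENNReal.ofReal ε) :
    (∫ x in (0 : ℝ)..1, ψ x) / 2048 ≤ ε * (n + 1) ^ 2 := by
  set m := 2 * (n + 1) with hm
  have hm0 : 0 < m := by omega
  have herr : ∀ s : Finset (Fin m),
      |smallestEigenvalue (bumpSum ψ s) - A.result (bumpSum ψ s)| ≤ ε := fun s =>
    (ENNReal.ofReal_le_ofReal_iff hε).1 ((le_iSup₂ (f := fun q (_ : q ∈ Q) =>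
      ENNReal.ofReal |smallestEigenvalue q - A.result q|) _ (hψ.bumpSum_mem_Q hm0 s)).trans hA)
  have hnum : A.numSamples (bumpSum ψ (∅ : Finset (Fin m))) ≤ n :=
    (le_iSup₂ (f := fun q (_ : q ∈ Q) => A.numSamples q) _ (hψ.bumpSum_mem_Q hm0 ∅)).trans hn
  have hfin : A.numSamples (bumpSum ψ (∅ : Finset (Fin m))) ≠ ⊤ :=
    (hnum.trans_lt (ENat.natCast_lt_top n)).ne
  set t := A.freeSet ψ (∅ : Finset (Fin m)) with ht
  have hcard : n + 1 ≤ t.card := by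
    have := (Algorithm.le_card_freeSet_add (A := A) (s := (∅ : Finset (Fin m))) hψ).trans
      (add_le_add_right hnum _)
    rw [← ht] at this
    norm_cast at this
    omega
  have hres : A.result (bumpSum ψ t) = A.result (bumpSum ψ (∅ : Finset (Fin m))) :=
    Algorithm.result_eq_of_free hfin fun k hk => by simpa using hk
  have hdiff := hψ.le_smallestEigenvalue_bumpSum_sub hm0 (Finset.empty_subset t)
  rw [Finset.sdiff_empty] at hdiff
  have h1 := herr t
  have h2 := herr ∅
  rw [hres] at h1
  rw [abs_le] at h1 h2
  have hJ := hψ.integral_pos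
  -- Both potentials receive the same output, so their eigenvalues are at most `2ε` apart.
  have h3 : ((n : ℝ) + 1) * ((∫ x in (0 : ℝ)..1, ψ x) / 128 / (m : ℝ) ^ 3) ≤ 2 * ε := by
    refine le_trans ?_ (hdiff.trans (by linarith [h1.2, h2.1]))
    gcongr
    exact_mod_cast hcard
  rw [hm] at h3
  push_cast at h3
  have hn1 : (0 : ℝ) < n + 1 := by positivity
  rw [show ((n : ℝ) + 1) * ((∫ x in (0 : ℝ)..1, ψ x) / 128 / (2 * ((n : ℝ) + 1)) ^ 3) =
    (∫ x in (0 : ℝ)..1, ψ x) / 1024 / ((n : ℝ) + 1) ^ 2 by field_simp; norm_num,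
    div_le_iff₀ (by positivity)] at h3
  linarith

open scoped symmDiff in
/-- The mean square error of a deterministic algorithm over all sums of `m` bumps. -/
lemma IsBump.sum_card_freeSet_le (hψ : IsBump ψ) (A : Algorithm) {m : ℕ} (hm : 0 < m) :
    ((∫ x in (0 : ℝ)..1, ψ x) / 128 / m ^ 3) ^ 2 / 4 *
      ∑ s : Finset (Fin m), ((A.freeSet ψ s).card : ℝ) ≤
      ∑ s : Finset (Fin m), (smallestEigenvalue (bumpSum ψ s) - A.result (bumpSum ψ s)) ^ 2 := by
  have hJ := hψ.integral_pos
  have hagree : ∀ s : Finset (Fin m), ∀ k ∈ A.freeSet ψ s, ∀ l ∉ A.freeSet ψ s,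
      l ∈ s ∆ {k} ↔ l ∈ s := by
    intro s k hk l hl
    have : l ≠ k := by rintro rfl; exact hl hk
    simp [Finset.mem_symmDiff, this]
  refine sum_card_le_sum_sq_sub (F := fun s => A.freeSet ψ s)
    (φ := fun s => A.result (bumpSum ψ s)) (Λ := fun s => smallestEigenvalue (bumpSum ψ s))
    (by positivity) (fun s k hk => ?_) (fun s k hk => ?_) fun s k hk => ?_
  · exact Algorithm.freeSet_eq_of_free (Algorithm.mem_freeSet.1 hk).1 (hagree s k hk)
  · exact Algorithm.result_eq_of_free (Algorithm.mem_freeSet.1 hk).1 (hagree s k hk)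
  · have := hψ.le_smallestEigenvalue_bumpSum_sub hm (Finset.subset_insert k s)
    rwa [Finset.insert_sdiff_of_notMem _ hk, Finset.sdiff_self,
      Finset.card_insert_of_notMem (by simp), Finset.card_empty, zero_add, Nat.cast_one,
      one_mul] at this

/-- The trade-off between the expected number of samples and the error of a randomized
algorithm. -/
lemma IsBump.le_of_error_le (hψ : IsBump ψ) {Ω : Type u} [MeasurableSpace Ω] {P : Measure Ω}
    [IsProbabilityMeasure P] {A : RandomizedAlgorithm Ω} {ε N : ℝ} (hε : 0 ≤ ε) (hN : 0 ≤ N)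
    (hnum : A.expectedNumSamples P ≤ ENNReal.ofReal N) (herr : A.error P ≤ ENNReal.ofReal ε)
    {m : ℕ} (hm : 0 < m) :
    ((∫ x in (0 : ℝ)..1, ψ x) / 128 / m ^ 3) ^ 2 / 4 * (m - N) ≤ ε ^ 2 := by
  set D := ((∫ x in (0 : ℝ)..1, ψ x) / 128 / (m : ℝ) ^ 3) ^ 2 / 4 with hD
  have hD0 : 0 ≤ D := by positivity
  set q : Finset (Fin m) → ℝ → ℝ := fun s => bumpSum ψ s with hq
  have hqQ : ∀ s, q s ∈ Q := hψ.bumpSum_mem_Q hm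
  set e : Finset (Fin m) → Ω → ℝ := fun s ω =>
    smallestEigenvalue (q s) - (A.alg ω).result (q s) with he
  have hem : ∀ s, Measurable fun ω => ‖e s ω‖ₑ ^ 2 := fun s =>
    ((measurable_const.sub (A.measurable_result (q s) (hqQ s))).enorm).pow_const 2
  have hnm : ∀ s, Measurable fun ω => ((A.alg ω).numSamples (q s) : ℝ≥0∞) := fun s =>
    (Measurable.of_discrete (f := fun n : ℕ∞ => (n : ℝ≥0∞))).comp
      (A.measurable_numSamples (q s) (hqQ s))
  have hepow : ∀ s, ∫⁻ ω, ‖e s ω‖ₑ ^ 2 ∂P ≤ ENNReal.ofReal (ε ^ 2) := by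
    intro s
    have h1 : eLpNorm (e s) 2 P ≤ ENNReal.ofReal ε := (le_iSup₂ (f := fun q (_ : q ∈ Q) =>
      eLpNorm (fun ω => smallestEigenvalue q - (A.alg ω).result q) 2 P) _ (hqQ s)).trans herr
    have h2 := eLpNorm_nnreal_pow_eq_lintegral (f := e s) (μ := P) (p := 2) (by norm_num)
    have h3 : ∫⁻ ω, ‖e s ω‖ₑ ^ 2 ∂P = eLpNorm (e s) 2 P ^ 2 := by
      simpa using h2.symm
    rw [h3, ENNReal.ofReal_pow hε]
    gcongr
  -- Eliminating the free sets for each `ω` avoids any question of their measurability; the additive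
  -- form allows infinitely many samples.
  have hpoint : ∀ ω, ENNReal.ofReal D * ∑ _s : Finset (Fin m), (m : ℝ≥0∞) ≤
      ∑ s, ‖e s ω‖ₑ ^ 2 + ENNReal.ofReal D * ∑ s, ((A.alg ω).numSamples (q s) : ℝ≥0∞) := by
    intro ω
    have h1 : ∀ s, (m : ℝ≥0∞) ≤
        ((A.alg ω).freeSet ψ s).card + ((A.alg ω).numSamples (q s) : ℝ≥0∞) := fun s => by
      exact_mod_cast ENat.toENNReal_le.2
        (Algorithm.le_card_freeSet_add (A := A.alg ω) (s := s) hψ)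
    have h2 : ENNReal.ofReal D * ∑ s : Finset (Fin m), (((A.alg ω).freeSet ψ s).card : ℝ≥0∞) ≤
        ∑ s, ‖e s ω‖ₑ ^ 2 := by
      have h3 := ENNReal.ofReal_le_ofReal (hψ.sum_card_freeSet_le (A.alg ω) hm)
      rw [ENNReal.ofReal_mul hD0, ENNReal.ofReal_sum_of_nonneg fun _ _ => Nat.cast_nonneg _,
        ENNReal.ofReal_sum_of_nonneg fun _ _ => sq_nonneg _] at h3
      simp only [ENNReal.ofReal_natCast] at h3
      refine h3.trans (le_of_eq (Finset.sum_congr rfl fun s _ => ?_))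
      rw [← sq_abs, ENNReal.ofReal_pow (abs_nonneg _), ← Real.norm_eq_abs, ofReal_norm]
    calc _ ≤ ENNReal.ofReal D * (∑ s : Finset (Fin m), (((A.alg ω).freeSet ψ s).card : ℝ≥0∞) +
          ∑ s, ((A.alg ω).numSamples (q s) : ℝ≥0∞)) := by
          rw [← Finset.sum_add_distrib]
          gcongr with s
          exact h1 s
      _ ≤ _ := by rw [mul_add]; gcongr
  have hint := lintegral_mono (μ := P) hpoint
  rw [lintegral_const, measure_univ, mul_one,
    lintegral_add_left (Finset.measurable_fun_sum _ fun s _ => hem s),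
    lintegral_finsetSum _ fun s _ => hem s,
    lintegral_const_mul _ (Finset.measurable_fun_sum _ fun s _ => hnm s),
    lintegral_finsetSum _ fun s _ => hnm s] at hint
  have hfinal : ENNReal.ofReal D * ∑ _s : Finset (Fin m), (m : ℝ≥0∞) ≤
      ∑ _s : Finset (Fin m), ENNReal.ofReal (ε ^ 2) +
        ENNReal.ofReal D * ∑ _s : Finset (Fin m), ENNReal.ofReal N := by
    refine hint.trans ?_
    gcongr with s _ s _
    · exact hepow s
    · exact (le_iSup₂ (f := fun q (_ : q ∈ Q) =>
        ∫⁻ ω, ((A.alg ω).numSamples q : ℝ≥0∞) ∂P) _ (hqQ s)).trans hnum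
  simp only [← ENNReal.ofReal_natCast m] at hfinal
  rw [← ENNReal.ofReal_sum_of_nonneg fun _ _ => by positivity,
    ← ENNReal.ofReal_sum_of_nonneg fun _ _ => by positivity,
    ← ENNReal.ofReal_sum_of_nonneg fun _ _ => hN, ← ENNReal.ofReal_mul hD0,
    ← ENNReal.ofReal_mul hD0, ← ENNReal.ofReal_add (by positivity)
      (mul_nonneg hD0 (Finset.sum_nonneg fun _ _ => hN)),
    ENNReal.ofReal_le_ofReal_iff (add_nonneg (by positivity)
      (mul_nonneg hD0 (Finset.sum_nonneg fun _ _ => hN)))] at hfinal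
  simp only [Finset.sum_const, nsmul_eq_mul] at hfinal
  have hc : (0 : ℝ) < (Finset.univ : Finset (Finset (Fin m))).card := by
    exact_mod_cast Finset.card_pos.2 Finset.univ_nonempty
  refine le_of_mul_le_mul_left ?_ hc
  linarith

/-- Lower bound for the deterministic complexity. -/
theorem exists_le_nWor : ∃ c > (0 : ℝ), ∃ ε₀ > (0 : ℝ), ∀ ε : ℝ, 0 < ε → ε ≤ ε₀ →
    ENNReal.ofReal (c * ε ^ (-(1 / 2) : ℝ)) ≤ (nWor ε : ℝ≥0∞) := by
  obtain ⟨ψ, hψ⟩ := exists_isBump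
  set κ := (∫ x in (0 : ℝ)..1, ψ x) / 2048 with hκ
  have hκ0 : 0 < κ := div_pos hψ.integral_pos (by norm_num)
  refine ⟨√κ / 2, by positivity, κ / 4, by positivity, fun ε hε hε₀ => ?_⟩
  set x := √κ / 2 * ε ^ (-(1 / 2) : ℝ) with hx
  have hx0 : 0 ≤ x := by positivity
  have hx2 : x ^ 2 * ε = κ / 4 := by
    rw [hx, mul_pow, div_pow, Real.sq_sqrt hκ0.le, ← Real.rpow_natCast (ε ^ _),
      ← Real.rpow_mul hε.le]
    norm_num [Real.rpow_neg_one]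
    field_simp
  -- Needed to absorb the shift in `n + 1`: from `n + 1 ≥ 2x` follows `n ≥ x`.
  have hx1 : 1 ≤ x := by
    by_contra! hlt
    nlinarith [mul_lt_mul_of_pos_right (pow_lt_one₀ hx0 hlt two_ne_zero) hε]
  have key : ∀ n : ℕ∞, (n < ⊤ ∧ ∃ A : Algorithm,
      A.worstNumSamples = n ∧ A.worstError ≤ ENNReal.ofReal ε) → (⌈x⌉₊ : ℕ∞) ≤ n := by
    rintro n ⟨hn, A, hA, herr⟩
    lift n to ℕ using hn.ne
    have h := hψ.le_of_worstError_le hε.le hA.le herr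
    rw [← hκ] at h
    rw [Nat.cast_le, Nat.ceil_le]
    have h1 : (2 * x) ^ 2 ≤ ((n : ℝ) + 1) ^ 2 := by
      refine le_of_mul_le_mul_right ?_ hε
      nlinarith
    have h2 := le_of_sq_le_sq h1 (by positivity)
    linarith
  have h := ENat.toENNReal_le.2 (le_sInf key)
  refine le_trans ?_ h
  rw [ENat.toENNReal_coe, ← ENNReal.ofReal_natCast]
  exact ENNReal.ofReal_le_ofReal (Nat.le_ceil x)

/-- Lower bound for the randomized complexity. -/
theorem exists_le_nRan : ∃ c > (0 : ℝ), ∃ ε₀ > (0 : ℝ), ∀ ε : ℝ, 0 < ε → ε ≤ ε₀ →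
    ENNReal.ofReal (c * ε ^ (-(2 / 5) : ℝ)) ≤ nRan.{u} ε := by
  obtain ⟨ψ, hψ⟩ := exists_isBump
  set κ := (∫ x in (0 : ℝ)..1, ψ x) / 128 with hκ
  have hκ0 : 0 < κ := div_pos hψ.integral_pos (by norm_num)
  -- Chosen so that `ε² m⁵ ≥ κ²/8` becomes `m ≥ 4cy`. With `m ≤ 2N + 2` and `cy ≥ 1` this yields `N
  -- ≥ 2cy - 1 ≥ cy`.
  obtain ⟨c, hc0, hc⟩ : ∃ c : ℝ, 0 < c ∧ (4 * c) ^ 5 = κ ^ 2 / 8 := by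
    refine ⟨(κ ^ 2 / 8) ^ (1 / 5 : ℝ) / 4, by positivity, ?_⟩
    rw [mul_div_cancel₀ _ (by norm_num), ← Real.rpow_natCast, ← Real.rpow_mul (by positivity)]
    norm_num
  refine ⟨c, hc0, √(c ^ 5), by positivity, fun ε hε hε₀ => ?_⟩
  set y := ε ^ (-(2 / 5) : ℝ) with hy
  have hy0 : 0 < y := by positivity
  have hy5 : y ^ 5 * ε ^ 2 = 1 := by
    rw [hy, ← Real.rpow_natCast, ← Real.rpow_mul hε.le, ← Real.rpow_natCast,
      ← Real.rpow_add hε]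
    norm_num
  have hcy : 1 ≤ c * y := by
    by_contra! hlt
    have h1 : (c * y) ^ 5 < 1 := pow_lt_one₀ (by positivity) hlt (by norm_num)
    have h2 : ε ^ 2 ≤ c ^ 5 := (Real.le_sqrt hε.le (by positivity)).1 hε₀
    have h3 : y ^ 5 * ε ^ 2 ≤ y ^ 5 * c ^ 5 := by gcongr
    rw [mul_pow] at h1
    linarith
  refine le_sInf ?_
  rintro n ⟨hn, Ω, _, P, _, A, hA, herr⟩
  obtain ⟨N, hN, rfl⟩ : ∃ N : ℝ, 0 ≤ N ∧ n = ENNReal.ofReal N :=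
    ⟨n.toReal, ENNReal.toReal_nonneg, (ENNReal.ofReal_toReal hn.ne).symm⟩
  refine ENNReal.ofReal_le_ofReal ?_
  -- Twice as many bumps as expected samples, so `m - N ≥ m/2`; the extra one keeps `m` positive.
  set m := ⌈2 * N⌉₊ + 1 with hm
  have hm1 : 2 * N ≤ m := by
    rw [hm]; push_cast; linarith [Nat.le_ceil (2 * N)]
  have hm2 : (m : ℝ) ≤ 2 * N + 2 := by
    rw [hm]; push_cast; linarith [Nat.ceil_lt_add_one (show 0 ≤ 2 * N by positivity)]
  have hm0 : (0 : ℝ) < m := by rw [hm]; positivity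
  have h := hψ.le_of_error_le hε.le hN hA.le herr (m := m) (Nat.succ_pos _)
  rw [← hκ] at h
  have h1 : κ ^ 2 / 8 ≤ ε ^ 2 * m ^ 5 := by
    have h2 : (κ / (m : ℝ) ^ 3) ^ 2 / 4 * (m / 2) ≤ ε ^ 2 := by
      refine le_trans ?_ h
      gcongr
      linarith
    calc κ ^ 2 / 8 = (κ / (m : ℝ) ^ 3) ^ 2 / 4 * (m / 2) * m ^ 5 := by field_simp; norm_num
      _ ≤ _ := by gcongr
  have h3 : (4 * c * y) ^ 5 ≤ (m : ℝ) ^ 5 := by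
    rw [mul_pow, hc]
    calc κ ^ 2 / 8 * y ^ 5 ≤ ε ^ 2 * m ^ 5 * y ^ 5 := by gcongr
      _ = (y ^ 5 * ε ^ 2) * m ^ 5 := by ring
      _ = _ := by rw [hy5, one_mul]
  have h4 := le_of_pow_le_pow_left₀ (by norm_num) hm0.le h3
  linarith

end SturmLiouville

theorem mainTheorem2 :
    (∃ c > (0 : ℝ), ∃ ε₀ > (0 : ℝ), ∀ ε : ℝ, 0 < ε → ε ≤ ε₀ →
      ENNReal.ofReal (c * ε ^ (-(1 / 2) : ℝ)) ≤ (SturmLiouville.nWor ε : ENNReal)) ∧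
    (∃ c > (0 : ℝ), ∃ ε₀ > (0 : ℝ), ∀ ε : ℝ, 0 < ε → ε ≤ ε₀ →
      ENNReal.ofReal (c * ε ^ (-(2 / 5) : ℝ)) ≤ SturmLiouville.nRan.{u} ε) :=
  ⟨SturmLiouville.exists_le_nWor, SturmLiouville.exists_le_nRan⟩
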